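/- Let $\varphi\colon[-1,1]\to\mathbb R$ be Lebesgue measurable with $$0<\varphi_{\min}=\inf_{x\in[-1,1]}|\varphi(x)|\le\varphi_{\max}=\sup_{x\in[-1,1]}|\varphi(x)|<\infty ,$$ let $(\alpha_k)_{k\ge0}$ be a sequence of positive reals with $\sum_{k\ge0}\alpha_k^{-1}<\infty$, and let $\lambda>0$ be such that $$\frac{\alpha_k}{\alpha_n}\le\lambda^{n-k}\frac{k!}{n!}\qquad\text{for all }n\ge0\text{ and }0\le k\le n .$$ Let $H(K)$, with norm $\|\cdot\|_K$, be the real reproducing kernel Hilbert space on $[-1,1]$ of the kernel $$K(x,y)=\varphi(x)\varphi(y)\sum_{k=0}^\infty\alpha_k^{-1}x^ky^k .$$ For $n\in\mathbb N$ consider all linear approximations of the form $A_nf=\sum_{k=1}^nf(x_k)\psi_k$, where $x_1,\dots,x_n\in[-1,1]$ are pairwise distinct points and $\psi_1,\dots,\psi_n\colon[-1,1]\to\mathbb R$ are Lebesgue measurable functions, and define $$e_2(A_n)=\sup_{0\ne f\in H(K)}\frac{\bigl(\int_{-1}^1|f(x)-(A_nf)(x)|^2\,dx\bigr)^{1/2}}{\|f\|_K}\in[0,\infty],\qquad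 e_2^{\min}(n)=\inf_{A_n}e_2(A_n),$$ the infimum being over all such approximations. Put $$c_L(\lambda)=\frac{e^{-\frac32\lambda+2\sqrt\lambda}}{2\sqrt\pi\,\lambda^{1/4}}\Bigl(3+\sqrt{\tfrac{\pi}{e}}+\frac{2}{\sqrt\pi\,\lambda^{1/4}}+\frac{7}{16\sqrt\lambda}+\sqrt\lambda\,(2+\lambda)\Bigr),$$ $$m_L(\lambda)=\max\Bigl\{5\lambda,\ \lambda\bigl(1+\tfrac\lambda2\bigr)^2,\ \tfrac9\lambda\Bigr\},$$ $$c_{1,2}=\frac{2\sqrt{2\pi}}{3e^3\sqrt{4+\lambda}}\,e^{-\frac1{32}\lambda^2}\varphi_{\min},\qquad c_{2,2}=2\sqrt{2c_L(\lambda)}\,\varphi_{\max}.$$ Then for every $n\in\mathbb N$ with $n\ge m_L(\lambda)$, $$c_{1,2}\,2^{-n}\alpha_n^{-1/2}\ \le\ e_2^{\min}(n)\ \le\ c_{2,2}\,n^{-1/8}e^{\sqrt{\lambda n}}\,2^{-n}\alpha_n^{-1/2}.$$ -/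

import Mathlib

open MeasureTheory
open scoped ENNReal

noncomputable section

namespace PowerSeriesKernel

/-- The interval `[-1, 1]`, on which all functions live. -/
abbrev Interval : Type := Set.Icc (-1 : ℝ) 1

/-- Lebesgue measure on `[-1, 1]`. A function `f` on `[-1, 1]` is Lebesgue measurable precisely
when `NullMeasurable f lebesgue`. -/
def lebesgue : Measure Interval := Measure.comap Subtype.val volume

/-- The weighted power series kernel `K(x, y) = φ(x) φ(y) ∑ₖ αₖ⁻¹ xᵏ yᵏ`. -/
def kernel (φ : Interval → ℝ) (α : ℕ → ℝ) (x y : Interval) : ℝ :=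
  φ x * φ y * ∑' k : ℕ, (α k)⁻¹ * (x : ℝ) ^ k * (y : ℝ) ^ k

/-- `H` is the reproducing kernel Hilbert space of the scalar kernel `K`. -/
def IsRKHSOf (H : Type*) [NormedAddCommGroup H] [InnerProductSpace ℝ H] [CompleteSpace H]
    {X : Type*} [RKHS ℝ H X ℝ] (K : X → X → ℝ) : Prop :=
  ∀ x y : X, RKHS.kernel H x y 1 = K x y

/-- `φ_min = inf |φ|` over `[-1, 1]`. -/
def phiMin (φ : Interval → ℝ) : ℝ := ⨅ x, |φ x|

/-- `φ_max = sup |φ|` over `[-1, 1]` (used only for bounded `φ`). -/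
def phiMax (φ : Interval → ℝ) : ℝ := ⨆ x, |φ x|

/-- The data of a linear approximation `f ↦ ∑ₖ f(xₖ) ψₖ` from `n` function evaluations: pairwise
distinct points `xₖ ∈ [-1, 1]` and Lebesgue measurable functions `ψₖ` on `[-1, 1]`. -/
structure LinearApprox (n : ℕ) where
  point : Fin n → Interval
  point_injective : Function.Injective point
  weight : Fin n → Interval → ℝ
  weight_measurable : ∀ k, NullMeasurable (weight k) lebesgue

/-- `(A f)(x) = ∑ₖ f(xₖ) ψₖ(x)`. -/
def LinearApprox.apply {n : ℕ} (A : LinearApprox n) (f : Interval → ℝ) : Interval → ℝ :=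
  fun x => ∑ k, f (A.point k) * A.weight k x

/-- The worst-case error `e₂(A) = sup_{0 ≠ f ∈ H} ‖f - A f‖₂ / ‖f‖_H`, possibly infinite. -/
def worstCaseError (H : Type*) [NormedAddCommGroup H] [InnerProductSpace ℝ H]
    [RKHS ℝ H Interval ℝ] {n : ℕ} (A : LinearApprox n) : ℝ≥0∞ :=
  ⨆ (f : H) (_ : f ≠ 0), eLpNorm (fun x => f x - A.apply f x) 2 lebesgue / ‖f‖ₑ

/-- The `n`-th minimal error `e₂^min(n) = inf_A e₂(A)`. -/
def minimalError (H : Type*) [NormedAddCommGroup H] [InnerProductSpace ℝ H]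
    [RKHS ℝ H Interval ℝ] (n : ℕ) : ℝ≥0∞ :=
  ⨅ A : LinearApprox n, worstCaseError H A

/-- The function `c_L`. -/
def cL (l : ℝ) : ℝ :=
  Real.exp (-(3 / 2) * l + 2 * √l) / (2 * √Real.pi * l ^ (1 / 4 : ℝ)) *
    (3 + √(Real.pi / Real.exp 1) + 2 / (√Real.pi * l ^ (1 / 4 : ℝ)) + 7 / (16 * √l)
      + √l * (2 + l))

/-- The function `m_L`. -/
def mL (l : ℝ) : ℝ :=
  max (5 * l) (max (l * (1 + l / 2) ^ 2) (9 / l))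

/-- The constant `c_{1,2}`. -/
def cLower (l : ℝ) (φ : Interval → ℝ) : ℝ :=
  2 * √(2 * Real.pi) / (3 * Real.exp 3 * √(4 + l)) * Real.exp (-(1 / 32) * l ^ 2) * phiMin φ

/-- The constant `c_{2,2}`. -/
def cUpper (l : ℝ) (φ : Interval → ℝ) : ℝ :=
  2 * √(2 * cL l) * phiMax φ

/-- The reproducing kernel Hilbert space of the weighted power series kernel exists. -/
theorem exists_isRKHSOf_kernel (φ : Interval → ℝ) (α : ℕ → ℝ) (hα : ∀ k, 0 < α k)
    (hsum : Summable fun k => (α k)⁻¹) :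
    ∃ (H : Type) (_ : NormedAddCommGroup H) (_ : InnerProductSpace ℝ H) (_ : CompleteSpace H)
      (_ : RKHS ℝ H Interval ℝ), IsRKHSOf H (kernel φ α) := by
  have hs : ∀ x y : Interval, Summable fun k : ℕ => (α k)⁻¹ * (x : ℝ) ^ k * (y : ℝ) ^ k := by
    intro x y
    refine Summable.of_norm_bounded hsum fun k => ?_
    have hx : |(x : ℝ)| ^ k ≤ 1 := pow_le_one₀ (abs_nonneg _) (abs_le.2 x.2)
    have hy : |(y : ℝ)| ^ k ≤ 1 := pow_le_one₀ (abs_nonneg _) (abs_le.2 y.2)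
    have h0 := (inv_pos.2 (hα k)).le
    rw [Real.norm_eq_abs, abs_mul, abs_mul, abs_of_nonneg h0, abs_pow, abs_pow, mul_assoc]
    exact mul_le_of_le_one_right h0 (mul_le_one₀ hx (by positivity) hy)
  let M : Matrix Interval Interval (ℝ →L[ℝ] ℝ) :=
    .of fun x y => kernel φ α x y • ContinuousLinearMap.id ℝ ℝ
  have hM : M.PosSemidef := by
    have tfae := RKHS.posSemidef_tfae (𝕜 := ℝ) (K := M)
    have h02 := tfae.out 0 2
    rw [h02]
    refine ⟨?_, fun v => ?_⟩
    · ext x y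
      simp [M, Matrix.conjTranspose_apply, ContinuousLinearMap.star_eq_adjoint, kernel, mul_comm,
        mul_left_comm, ContinuousLinearMap.adjoint_id]
    · have key : (v.sum fun x w => v.sum fun x' w' => inner ℝ (M x' x w) w')
          = ∑' k : ℕ, (α k)⁻¹ * (v.sum fun x w => w * φ x * (x : ℝ) ^ k) ^ 2 := by
        simp only [Finsupp.sum]
        have h1 : ∀ x ∈ v.support, ∀ x' ∈ v.support, inner ℝ (M x' x (v x)) (v x')
            = ∑' k : ℕ, (v x * φ x * (v x' * φ x')) *
              ((α k)⁻¹ * (x' : ℝ) ^ k * (x : ℝ) ^ k) := by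
          intro x _ x' _
          rw [tsum_mul_left]
          simp [M, kernel]
          ring
        rw [Finset.sum_congr rfl fun x hx => Finset.sum_congr rfl (h1 x hx)]
        rw [Finset.sum_congr rfl fun x _ => (Summable.tsum_finsetSum
          fun x' _ => (hs x' x).mul_left _).symm]
        rw [← Summable.tsum_finsetSum
          fun x _ => summable_sum fun x' _ => (hs x' x).mul_left _]
        refine tsum_congr fun k => ?_
        rw [sq, Finset.sum_mul_sum, Finset.mul_sum]
        refine Finset.sum_congr rfl fun x _ => ?_
        rw [Finset.mul_sum]
        exact Finset.sum_congr rfl fun x' _ => by ring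
      rw [key]
      exact tsum_nonneg fun k => mul_nonneg (inv_pos.2 (hα k)).le (sq_nonneg _)
  have : Fact M.PosSemidef := ⟨hM⟩
  refine ⟨RKHS.OfKernel M, inferInstance, inferInstance, inferInstance, inferInstance, ?_⟩
  intro x y
  rw [RKHS.OfKernel.kernel_ofKernel]
  simp [M]

end PowerSeriesKernel

end

/-!
The feature map `x ↦ (φ(x) xᵏ / √αₖ)ₖ` into `ℓ²` represents the kernel, so `φ p` lies in `H` for
every polynomial `p`, with squared norm at most `∑ αₖ pₖ²`.

For the lower bound, take for `p` the nodal polynomial of the given points: `φ p` vanishes at all of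
them. Expanding `p` in the polynomials `U_j`, whose coefficients are explicit and which are
orthogonal for the weight `√(1 - x²) ≤ 1`, bounds `∑ αₖ pₖ²` by a multiple of `4ⁿ αₙ ∫ p²`.

For the upper bound, interpolate `f / φ` at the zeros of `Tₙ`. The squared error at `x` is at most
`φ(x)² ‖f‖² ∑ₖ αₖ⁻¹ Eₖ²`, where `Eₖ` is the error of interpolating the `k`-th power. The
interpolant of a `T_k` is another `±T_j` with `j < n` or zero, and writing `xᴺ` as a random walk in
the index of `T`, through `x T_k = (T_{k+1} + T_{k-1}) / 2`, gives
`|E_N| ≤ 4 sⁿ ((s + s⁻¹) / 2)ᴺ` for every `s ∈ (0, 1]`.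
-/

noncomputable section

namespace PowerSeriesKernel

/-! ### Feature maps of reproducing kernel Hilbert spaces -/

section FeatureMap

open scoped InnerProductSpace

variable {𝕜 : Type*} [RCLike 𝕜] {X : Type*} (H : Type*) [NormedAddCommGroup H]
  [InnerProductSpace 𝕜 H] [CompleteSpace H] [RKHS 𝕜 H X 𝕜] {E : Type*} [NormedAddCommGroup E]
  [InnerProductSpace 𝕜 E]

/-- The function `K(·, x) ∈ H`, where `K` is the scalar reproducing kernel of `H`. -/
def kerSection (x : X) : H := RKHS.kerFun H x (1 : 𝕜)

/-- `Φ` is a feature map of the scalar reproducing kernel `K` of `H`: `⟪Φ x, Φ y⟫ = K(x, y)`. It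
is not required that the values of `Φ` span a dense subspace. -/
def IsFeatureMap (Φ : X → E) : Prop :=
  ∀ x y, ⟪Φ x, Φ y⟫_𝕜 = RKHS.kernel H x y (1 : 𝕜)

variable {H}

lemma inner_kerSection_left (x : X) (f : H) : ⟪kerSection H x, f⟫_𝕜 = f x := by
  simp [kerSection]

variable (H) in
lemma inner_kerSection_kerSection (x y : X) :
    ⟪kerSection H x, kerSection H y⟫_𝕜 = RKHS.kernel H x y (1 : 𝕜) := by
  rw [inner_kerSection_left, kerSection, RKHS.kerFun_apply]

variable (H) in
lemma denseRange_linearCombination_kerSection :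
    DenseRange (Finsupp.linearCombination 𝕜 (kerSection H : X → H)) := by
  have hspan : Submodule.span 𝕜 {RKHS.kerFun H x v | (x : X) (v : 𝕜)} ≤
      LinearMap.range (Finsupp.linearCombination 𝕜 (kerSection H : X → H)) := by
    rw [Submodule.span_le]
    rintro _ ⟨x, v, rfl⟩
    exact ⟨Finsupp.single x v, by simp [kerSection, ← map_smul]⟩
  have hdense := Submodule.topologicalClosure_mono hspan
  rw [RKHS.kerFun_dense, top_le_iff] at hdense
  rw [DenseRange, ← LinearMap.coe_range]
  exact Submodule.dense_iff_topologicalClosure_eq_top.2 hdense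

namespace IsFeatureMap

variable {Φ : X → E}

lemma norm_linearCombination (hΦ : IsFeatureMap H Φ) (c : X →₀ 𝕜) :
    ‖Finsupp.linearCombination 𝕜 Φ c‖ =
      ‖Finsupp.linearCombination 𝕜 (kerSection H : X → H) c‖ := by
  rw [@norm_eq_sqrt_re_inner 𝕜, @norm_eq_sqrt_re_inner 𝕜 H, Finsupp.linearCombination_apply,
    Finsupp.linearCombination_apply]
  simp only [Finsupp.sum_inner, Finsupp.inner_sum, inner_smul_left, inner_smul_right, hΦ _ _,
    inner_kerSection_kerSection]

variable [CompleteSpace E]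

lemma exists_linearIsometry (hΦ : IsFeatureMap H Φ) :
    ∃ V : H →ₗᵢ[𝕜] E, ∀ x, V (kerSection H x) = Φ x := by
  set e := Finsupp.linearCombination 𝕜 (kerSection H : X → H) with he
  set g := Finsupp.linearCombination 𝕜 Φ with hg
  have hdense : DenseRange e := denseRange_linearCombination_kerSection H
  have hext : ∀ c, g.extendOfNorm e (e c) = g c :=
    g.extendOfNorm_eq hdense ⟨1, fun c => by rw [one_mul, hg, hΦ.norm_linearCombination c]⟩
  have hnorm : ∀ f, ‖g.extendOfNorm e f‖ = ‖f‖ := fun f =>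
    hdense.induction_on f (isClosed_eq (by fun_prop) (by fun_prop)) fun c => by
      rw [hext, hg, hΦ.norm_linearCombination c]
  refine ⟨⟨(g.extendOfNorm e).toLinearMap, hnorm⟩, fun x => ?_⟩
  simpa [he, hg] using hext (Finsupp.single x 1)

lemma exists_apply_eq_inner (hΦ : IsFeatureMap H Φ) (a : E) :
    ∃ f : H, (∀ x, f x = ⟪Φ x, a⟫_𝕜) ∧ ‖f‖ ≤ ‖a‖ := by
  obtain ⟨V, hV⟩ := hΦ.exists_linearIsometry
  refine ⟨V.toContinuousLinearMap.adjoint a, fun x => ?_, ?_⟩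
  · rw [← inner_kerSection_left, ContinuousLinearMap.adjoint_inner_right,
      LinearIsometry.coe_toContinuousLinearMap, hV]
  · refine (ContinuousLinearMap.le_opNorm _ a).trans (mul_le_of_le_one_left (norm_nonneg a) ?_)
    rw [LinearIsometryEquiv.norm_map]
    exact V.norm_toContinuousLinearMap_le

lemma norm_apply_sub_sum_le (hΦ : IsFeatureMap H Φ) {ι : Type*} (s : Finset ι) (c : ι → 𝕜)
    (y : ι → X) (x : X) (f : H) :
    ‖f x - ∑ j ∈ s, c j * f (y j)‖ ≤ ‖Φ x - ∑ j ∈ s, starRingEnd 𝕜 (c j) • Φ (y j)‖ * ‖f‖ := by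
  obtain ⟨V, hV⟩ := hΦ.exists_linearIsometry
  set k := kerSection H x - ∑ j ∈ s, starRingEnd 𝕜 (c j) • kerSection H (y j) with hk
  have hVk : V k = Φ x - ∑ j ∈ s, starRingEnd 𝕜 (c j) • Φ (y j) := by simp [hk, hV]
  have hinner : ⟪k, f⟫_𝕜 = f x - ∑ j ∈ s, c j * f (y j) := by
    simp [hk, inner_sub_left, sum_inner, inner_smul_left, inner_kerSection_left]
  rw [← hVk, V.norm_map, ← hinner]
  exact norm_inner_le_norm k f

end IsFeatureMap

end FeatureMap

section PowerSeriesFeature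

open Polynomial

lemma summable_inv_mul_pow_mul_pow {α : ℕ → ℝ} (hα_pos : ∀ k, 0 < α k)
    (hα_sum : Summable fun k => (α k)⁻¹) (x y : Interval) :
    Summable fun k : ℕ => (α k)⁻¹ * (x : ℝ) ^ k * (y : ℝ) ^ k := by
  refine Summable.of_norm_bounded hα_sum fun k => ?_
  have hx : ‖(x : ℝ) ^ k‖ ≤ 1 := by
    simpa only [norm_pow] using pow_le_one₀ (norm_nonneg _) (abs_le.2 x.2)
  have hy : ‖(y : ℝ) ^ k‖ ≤ 1 := by
    simpa only [norm_pow] using pow_le_one₀ (norm_nonneg _) (abs_le.2 y.2)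
  have hαk := (inv_pos.2 (hα_pos k)).le
  rw [mul_assoc, norm_mul, norm_mul, Real.norm_of_nonneg hαk]
  exact mul_le_of_le_one_right hαk (mul_le_one₀ hx (norm_nonneg _) hy)

/-- The feature map `x ↦ (φ(x) xᵏ / √αₖ)ₖ` into `ℓ²` of the power series kernel. -/
def feature (φ : Interval → ℝ) {α : ℕ → ℝ} (hα_pos : ∀ k, 0 < α k)
    (hα_sum : Summable fun k => (α k)⁻¹) (x : Interval) : lp (fun _ : ℕ => ℝ) 2 :=
  ⟨fun k => (√(α k))⁻¹ * (φ x * (x : ℝ) ^ k), by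
    refine memℓp_gen (((summable_inv_mul_pow_mul_pow hα_pos hα_sum x x).mul_left (φ x ^ 2)).congr
      fun k => ?_)
    simp only [Real.norm_eq_abs, ENNReal.toReal_ofNat, Real.rpow_two, sq_abs, mul_pow, inv_pow,
      Real.sq_sqrt (hα_pos k).le]
    ring⟩

variable {φ : Interval → ℝ} {α : ℕ → ℝ}

lemma feature_apply (hα_pos : ∀ k, 0 < α k) (hα_sum : Summable fun k => (α k)⁻¹)
    (x : Interval) (k : ℕ) :
    feature φ hα_pos hα_sum x k = (√(α k))⁻¹ * (φ x * (x : ℝ) ^ k) := rfl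

lemma inner_feature (hα_pos : ∀ k, 0 < α k) (hα_sum : Summable fun k => (α k)⁻¹)
    (x y : Interval) :
    inner ℝ (feature φ hα_pos hα_sum x) (feature φ hα_pos hα_sum y) = kernel φ α x y := by
  rw [lp.inner_eq_tsum, kernel, ← tsum_mul_left]
  refine tsum_congr fun k => ?_
  have hsqrt : (α k)⁻¹ = (√(α k))⁻¹ * (√(α k))⁻¹ := by
    rw [← mul_inv, Real.mul_self_sqrt (hα_pos k).le]
  simp only [feature_apply, hsqrt, RCLike.inner_apply, conj_trivial]
  ring

lemma norm_sq_feature_sub_sum (hα_pos : ∀ k, 0 < α k) (hα_sum : Summable fun k => (α k)⁻¹)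
    {ι : Type*} (s : Finset ι) (c : ι → ℝ) (y : ι → Interval) (x : Interval) :
    ‖feature φ hα_pos hα_sum x - ∑ j ∈ s, c j • feature φ hα_pos hα_sum (y j)‖ ^ 2 =
      ∑' k : ℕ, (α k)⁻¹ *
        (φ x * (x : ℝ) ^ k - ∑ j ∈ s, c j * (φ (y j) * (y j : ℝ) ^ k)) ^ 2 := by
  rw [← real_inner_self_eq_norm_sq, lp.inner_eq_tsum]
  refine tsum_congr fun k => ?_
  have hcoord : (feature φ hα_pos hα_sum x -
      ∑ j ∈ s, c j • feature φ hα_pos hα_sum (y j) : lp (fun _ : ℕ => ℝ) 2) k =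
      (√(α k))⁻¹ * (φ x * (x : ℝ) ^ k - ∑ j ∈ s, c j * (φ (y j) * (y j : ℝ) ^ k)) := by
    simp only [lp.coeFn_sub, lp.coeFn_sum, lp.coeFn_smul, Pi.sub_apply, Finset.sum_apply,
      Pi.smul_apply, feature_apply, smul_eq_mul, mul_sub, Finset.mul_sum, mul_left_comm]
  rw [hcoord, RCLike.inner_apply, conj_trivial, ← sq, mul_pow, inv_pow,
    Real.sq_sqrt (hα_pos k).le]

variable {H : Type*} [NormedAddCommGroup H] [InnerProductSpace ℝ H] [CompleteSpace H]
  [RKHS ℝ H Interval ℝ]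

lemma IsRKHSOf.isFeatureMap_feature (hH : IsRKHSOf H (kernel φ α)) (hα_pos : ∀ k, 0 < α k)
    (hα_sum : Summable fun k => (α k)⁻¹) :
    IsFeatureMap H (feature φ hα_pos hα_sum) :=
  fun x y => (inner_feature hα_pos hα_sum x y).trans (hH x y).symm

lemma IsRKHSOf.exists_apply_eq_mul_eval (hH : IsRKHSOf H (kernel φ α)) (hα_pos : ∀ k, 0 < α k)
    (hα_sum : Summable fun k => (α k)⁻¹) (p : ℝ[X]) :
    ∃ f : H, (∀ x, f x = φ x * p.eval (x : ℝ)) ∧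
      ‖f‖ ^ 2 ≤ ∑ k ∈ Finset.range (p.natDegree + 1), α k * p.coeff k ^ 2 := by
  let a : lp (fun _ : ℕ => ℝ) 2 :=
    ∑ k ∈ Finset.range (p.natDegree + 1), lp.single 2 k (√(α k) * p.coeff k)
  have ha : ‖a‖ ^ 2 = ∑ k ∈ Finset.range (p.natDegree + 1), α k * p.coeff k ^ 2 := by
    have := lp.norm_sum_single (p := 2) (E := fun _ : ℕ => ℝ) (by norm_num)
      (fun k => √(α k) * p.coeff k) (Finset.range (p.natDegree + 1))
    simp only [ENNReal.toReal_ofNat, Real.rpow_two] at this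
    simp only [a, this, Real.norm_eq_abs, sq_abs, mul_pow, Real.sq_sqrt (hα_pos _).le]
  obtain ⟨f, hf, hfa⟩ := (hH.isFeatureMap_feature hα_pos hα_sum).exists_apply_eq_inner a
  refine ⟨f, fun x => ?_, ha ▸ pow_le_pow_left₀ (norm_nonneg f) hfa 2⟩
  rw [hf, inner_sum, eval_eq_sum_range, Finset.mul_sum]
  refine Finset.sum_congr rfl fun k _ => ?_
  have hαk : √(α k) ≠ 0 := (Real.sqrt_pos.2 (hα_pos k)).ne'
  rw [lp.inner_single_right, feature_apply, RCLike.inner_apply, conj_trivial]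
  field_simp

lemma IsRKHSOf.sq_apply_sub_sum_le (hH : IsRKHSOf H (kernel φ α)) (hα_pos : ∀ k, 0 < α k)
    (hα_sum : Summable fun k => (α k)⁻¹) {ι : Type*} (s : Finset ι) (c : ι → ℝ)
    (y : ι → Interval) (x : Interval) (f : H) :
    (f x - ∑ j ∈ s, c j * f (y j)) ^ 2 ≤
      (∑' k : ℕ, (α k)⁻¹ *
        (φ x * (x : ℝ) ^ k - ∑ j ∈ s, c j * (φ (y j) * (y j : ℝ) ^ k)) ^ 2) * ‖f‖ ^ 2 := by
  have h := (hH.isFeatureMap_feature hα_pos hα_sum).norm_apply_sub_sum_le s c y x f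
  simp only [conj_trivial, Real.norm_eq_abs] at h
  rw [← norm_sq_feature_sub_sum hα_pos hα_sum, ← mul_pow, ← sq_abs]
  exact pow_le_pow_left₀ (abs_nonneg _) h 2

end PowerSeriesFeature

/-! ### Coefficients of the Chebyshev polynomials of the second kind -/

section ChebyshevCoeff

open Polynomial Finset

variable (R : Type*) [CommRing R]

lemma coeff_zero_U_add_two (j : ℤ) :
    (Chebyshev.U R (j + 2)).coeff 0 = -(Chebyshev.U R j).coeff 0 := by
  simp [Chebyshev.U_add_two, mul_assoc]

lemma coeff_succ_U_add_two (j : ℤ) (i : ℕ) :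
    (Chebyshev.U R (j + 2)).coeff (i + 1) =
      2 * (Chebyshev.U R (j + 1)).coeff i - (Chebyshev.U R j).coeff (i + 1) := by
  rw [Chebyshev.U_add_two, mul_assoc, ← C_ofNat, coeff_sub, coeff_C_mul, coeff_X_mul]

lemma coeff_U_eq_zero {i j : ℕ} (hij : ∀ k, i + 2 * k ≠ j) : (Chebyshev.U R j).coeff i = 0 := by
  induction j using Nat.twoStepInduction generalizing i with
  | zero => simp [coeff_one, show i ≠ 0 from hij 0]
  | one =>
    have hi : 1 ≠ i := (hij 0).symm
    rw [Nat.cast_one, Chebyshev.U_one, ← C_ofNat, coeff_C_mul, coeff_X_of_ne_one hi.symm, mul_zero]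
  | more j ih₀ ih₁ =>
    push_cast
    cases i with
    | zero => rw [coeff_zero_U_add_two, ih₀ fun k hk => hij (k + 1) (by omega), neg_zero]
    | succ i =>
      have h₁ := ih₁ (i := i) fun k hk => hij k (by omega)
      rw [Nat.cast_succ] at h₁
      rw [coeff_succ_U_add_two, h₁, ih₀ fun k hk => hij (k + 1) (by omega), mul_zero, sub_zero]

lemma coeff_U_add_two_mul (i k : ℕ) :
    (Chebyshev.U R ((i + 2 * k : ℕ) : ℤ)).coeff i = (-1) ^ k * 2 ^ i * (i + k).choose k := by
  induction k generalizing i with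
  | zero =>
    induction i using Nat.twoStepInduction with
    | zero => simp
    | one => simp [← C_ofNat]
    | more i _ ih =>
      have hcoeff : (Chebyshev.U R (i : ℤ)).coeff (i + 2) = 0 :=
        coeff_U_eq_zero R fun k => by omega
      simp only [mul_zero, add_zero, pow_zero, one_mul, Nat.choose_zero_right, Nat.cast_one,
        mul_one, Nat.cast_add, Nat.cast_ofNat] at ih ⊢
      rw [coeff_succ_U_add_two, ih, hcoeff]
      ring
  | succ k ih =>
    induction i with
    | zero =>
      have h₀ := ih 0
      simp only [zero_add, Nat.choose_self] at h₀ ⊢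
      rw [show ((2 * (k + 1) : ℕ) : ℤ) = (2 * k : ℕ) + 2 by push_cast; ring,
        coeff_zero_U_add_two, h₀]
      ring
    | succ i ihi =>
      have hchoose : (i + 1 + (k + 1)).choose (k + 1) =
          (i + 1 + k).choose k + (i + (k + 1)).choose (k + 1) := by
        rw [← add_assoc (i + 1), Nat.choose_succ_succ, add_right_comm i 1 k, add_assoc i k 1]
      rw [show ((i + 1 + 2 * (k + 1) : ℕ) : ℤ) = (i + 1 + 2 * k : ℕ) + 2 by push_cast; ring,
        coeff_succ_U_add_two, ih, show ((i + 1 + 2 * k : ℕ) : ℤ) + 1 = (i + 2 * (k + 1) : ℕ) by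
          push_cast; ring, ihi, hchoose]
      push_cast
      ring

variable {M : Type*} [AddCommMonoid M]

lemma sum_range_coeff_U (g : ℕ → R → M) (hg : ∀ i, g i 0 = 0) {j n : ℕ} (hjn : j ≤ n) :
    ∑ i ∈ range (n + 1), g i ((Chebyshev.U R j).coeff i) =
      ∑ k ∈ range (j / 2 + 1), g (j - 2 * k) ((Chebyshev.U R j).coeff (j - 2 * k)) := by
  have hinj : Set.InjOn (fun k => j - 2 * k) (range (j / 2 + 1)) := fun a ha b hb hab => by
    simp only [coe_range, Set.mem_Iio] at ha hb hab
    omega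
  rw [← sum_image hinj (f := fun i => g i ((Chebyshev.U R j).coeff i))]
  refine (sum_subset (fun i hi => ?_) fun i _ hi => ?_).symm
  · obtain ⟨k, -, rfl⟩ := mem_image.1 hi
    exact mem_range.2 (by omega)
  · rw [coeff_U_eq_zero R, hg]
    exact fun k hk => hi (mem_image.2 ⟨k, mem_range.2 (by omega), by omega⟩)

end ChebyshevCoeff

/-! ### Sequences of factorial growth -/

section FactorialGrowth

open Polynomial Finset
open scoped Nat

/-- The growth condition `αₖ / αₙ ≤ lⁿ⁻ᵏ k! / n!` for `k ≤ n` on the weights of a power series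
kernel. -/
def FactorialRatioBound (α : ℕ → ℝ) (l : ℝ) : Prop :=
  ∀ n k : ℕ, k ≤ n → α k / α n ≤ l ^ (n - k) * ((k ! : ℝ) / (n ! : ℝ))

lemma sq_choose_mul_factorial_div_factorial_le (i k : ℕ) :
    ((i + k).choose k : ℝ) ^ 2 * ((i ! : ℝ) / ((i + 2 * k)! : ℝ)) ≤ 1 / (k ! : ℝ) := by
  have hchoose : ((i + k).choose k : ℝ) * i ! * k ! = (i + k)! :=
    mod_cast Nat.add_choose_mul_factorial_mul_factorial i k
  have hchoose' : ((i + 2 * k).choose k : ℝ) * (i + k)! * k ! = (i + 2 * k)! := by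
    have := Nat.add_choose_mul_factorial_mul_factorial (i + k) k
    rw [add_assoc, ← two_mul] at this
    exact_mod_cast this
  have hle : ((i + k).choose k : ℝ) ≤ (i + 2 * k).choose k :=
    mod_cast Nat.choose_le_choose k (by omega)
  have hk : (1 : ℝ) ≤ k ! := mod_cast Nat.factorial_pos k
  rw [← mul_div_assoc, div_le_div_iff₀ (by positivity) (by positivity), one_mul, ← hchoose',
    ← hchoose]
  set c := ((i + k).choose k : ℝ)
  set c' := ((i + 2 * k).choose k : ℝ)
  have : 0 ≤ c := Nat.cast_nonneg _
  calc c ^ 2 * i ! * k ! = c * (c * i ! * k !) * 1 := by ring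
    _ ≤ c' * (c * i ! * k !) * k ! := by gcongr
    _ = _ := by ring

variable {α : ℕ → ℝ} {l : ℝ}

lemma FactorialRatioBound.le_mul (hα : FactorialRatioBound α l) (hα_pos : ∀ k, 0 < α k)
    (k m : ℕ) : α k ≤ l ^ m * ((k ! : ℝ) / ((k + m)! : ℝ)) * α (k + m) := by
  have h := (div_le_iff₀ (hα_pos (k + m))).1 (hα (k + m) k (Nat.le_add_right k m))
  rwa [Nat.add_sub_cancel_left] at h

lemma FactorialRatioBound.mul_sq_coeff_U_le (hα : FactorialRatioBound α l)
    (hα_pos : ∀ k, 0 < α k) (i k : ℕ) :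
    α i * (Chebyshev.U ℝ ((i + 2 * k : ℕ) : ℤ)).coeff i ^ 2 ≤
      4 ^ (i + 2 * k) * α (i + 2 * k) * ((l ^ 2 / 16) ^ k / k !) := by
  have hcoeff : (Chebyshev.U ℝ ((i + 2 * k : ℕ) : ℤ)).coeff i ^ 2 =
      4 ^ i * ((i + k).choose k : ℝ) ^ 2 := by
    rw [coeff_U_add_two_mul, mul_pow, mul_pow, ← pow_mul, mul_comm k, pow_mul, neg_one_sq, one_pow,
      one_mul, ← pow_mul, mul_comm i, pow_mul]
    norm_num
  have hα_nonneg := (hα_pos (i + 2 * k)).le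
  calc α i * (Chebyshev.U ℝ ((i + 2 * k : ℕ) : ℤ)).coeff i ^ 2
      ≤ l ^ (2 * k) * ((i ! : ℝ) / ((i + 2 * k)! : ℝ)) * α (i + 2 * k) *
          (4 ^ i * ((i + k).choose k : ℝ) ^ 2) := by
        rw [hcoeff]
        exact mul_le_mul_of_nonneg_right (hα.le_mul hα_pos i (2 * k)) (by positivity)
    _ = 4 ^ i * α (i + 2 * k) * (l ^ 2) ^ k *
          (((i + k).choose k : ℝ) ^ 2 * ((i ! : ℝ) / ((i + 2 * k)! : ℝ))) := by
        rw [pow_mul]; ring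
    _ ≤ 4 ^ i * α (i + 2 * k) * (l ^ 2) ^ k * (1 / (k ! : ℝ)) := by
        gcongr
        exact sq_choose_mul_factorial_div_factorial_le i k
    _ = 4 ^ (i + 2 * k) * α (i + 2 * k) * ((l ^ 2 / 16) ^ k / k !) := by
        rw [pow_add, pow_mul 4 2 k, div_pow]
        norm_num
        field_simp

lemma FactorialRatioBound.sum_mul_sq_coeff_U_le (hα : FactorialRatioBound α l)
    (hα_pos : ∀ k, 0 < α k) {j n : ℕ} (hjn : j ≤ n) :
    ∑ i ∈ range (n + 1), α i * (Chebyshev.U ℝ j).coeff i ^ 2 ≤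
      4 ^ j * α j * Real.exp (l ^ 2 / 16) := by
  have hα_nonneg := (hα_pos j).le
  calc ∑ i ∈ range (n + 1), α i * (Chebyshev.U ℝ j).coeff i ^ 2
      = ∑ k ∈ range (j / 2 + 1), α (j - 2 * k) * (Chebyshev.U ℝ j).coeff (j - 2 * k) ^ 2 :=
        sum_range_coeff_U ℝ (fun i x => α i * x ^ 2) (fun i => by simp) hjn
    _ ≤ ∑ k ∈ range (j / 2 + 1), 4 ^ j * α j * ((l ^ 2 / 16) ^ k / k !) := by
        refine sum_le_sum fun k hk => ?_
        obtain ⟨i, rfl⟩ : ∃ i, j = i + 2 * k :=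
          ⟨j - 2 * k, by have := mem_range.1 hk; omega⟩
        rw [Nat.add_sub_cancel]
        exact hα.mul_sq_coeff_U_le hα_pos i k
    _ ≤ 4 ^ j * α j * Real.exp (l ^ 2 / 16) := by
        rw [← mul_sum]
        gcongr
        exact Real.sum_le_exp_of_nonneg (by positivity) _

lemma FactorialRatioBound.pos (hα : FactorialRatioBound α l) (hα_pos : ∀ k, 0 < α k) : 0 < l := by
  simpa using (div_pos (hα_pos 0) (hα_pos 1)).trans_le (hα 1 0 zero_le_one)

lemma natCast_add_one_pow_le {i N : ℕ} (hiN : i ≤ N) :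
    ((N : ℝ) + 1) ^ i ≤ Real.exp 1 * (N : ℝ) ^ i := by
  rcases N.eq_zero_or_pos with rfl | hN
  · obtain rfl := Nat.le_zero.1 hiN
    simp
  have hN' : (0 : ℝ) < N := Nat.cast_pos.2 hN
  calc ((N : ℝ) + 1) ^ i = (1 / (N : ℝ) + 1) ^ i * (N : ℝ) ^ i := by
        rw [← mul_pow, add_mul, div_mul_cancel₀ _ hN'.ne', one_mul, add_comm]
    _ ≤ Real.exp (1 / (N : ℝ)) ^ i * (N : ℝ) ^ i := by
        gcongr
        exact Real.add_one_le_exp _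
    _ = Real.exp (i / N) * (N : ℝ) ^ i := by rw [← Real.exp_nat_mul, mul_one_div]
    _ ≤ Real.exp 1 * (N : ℝ) ^ i := by
        gcongr
        exact (div_le_one hN').2 (Nat.cast_le.2 hiN)

lemma natCast_add_pow_mul_factorial_le (j i : ℕ) :
    ((j + i : ℕ) : ℝ) ^ i * (j ! : ℝ) ≤ Real.exp 1 ^ i * ((j + i)! : ℝ) := by
  induction i with
  | zero => simp
  | succ i ih =>
    rw [← add_assoc, Nat.factorial_succ, Nat.cast_mul, Nat.cast_succ]
    calc (((j + i : ℕ) : ℝ) + 1) ^ (i + 1) * j !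
        = (((j + i : ℕ) : ℝ) + 1) * ((((j + i : ℕ) : ℝ) + 1) ^ i * j !) := by ring
      _ ≤ (((j + i : ℕ) : ℝ) + 1) * (Real.exp 1 * ((j + i : ℕ) : ℝ) ^ i * j !) := by
          gcongr
          exact natCast_add_one_pow_le (Nat.le_add_left i j)
      _ = (((j + i : ℕ) : ℝ) + 1) * Real.exp 1 * (((j + i : ℕ) : ℝ) ^ i * j !) := by ring
      _ ≤ (((j + i : ℕ) : ℝ) + 1) * Real.exp 1 * (Real.exp 1 ^ i * (j + i)!) := by gcongr
      _ = Real.exp 1 ^ (i + 1) * ((((j + i : ℕ) : ℝ) + 1) * (j + i)!) := by ring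

lemma FactorialRatioBound.four_pow_mul_le (hα : FactorialRatioBound α l)
    (hα_pos : ∀ k, 0 < α k) {j i : ℕ} (hl : l ≤ (j + i : ℕ)) :
    4 ^ j * α j ≤ 4 ^ (j + i) * α (j + i) * (3 / 4) ^ i := by
  have hl_pos := hα.pos hα_pos
  have hratio : l ^ i * ((j ! : ℝ) / ((j + i)! : ℝ)) ≤ Real.exp 1 ^ i := by
    rw [← mul_div_assoc, div_le_iff₀ (by positivity)]
    exact le_trans (by gcongr) (natCast_add_pow_mul_factorial_le j i)
  have hexp : Real.exp 1 ≤ 3 := Real.exp_one_lt_three.le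
  have hα_nonneg := (hα_pos (j + i)).le
  calc 4 ^ j * α j ≤ 4 ^ j * (3 ^ i * α (j + i)) := by
        gcongr
        refine (hα.le_mul hα_pos j i).trans ?_
        gcongr
        exact hratio.trans (by gcongr)
    _ = 4 ^ (j + i) * α (j + i) * (3 / 4) ^ i := by
        rw [div_pow, pow_add]
        field_simp

lemma FactorialRatioBound.sum_four_pow_mul_le (hα : FactorialRatioBound α l)
    (hα_pos : ∀ k, 0 < α k) {n : ℕ} (hn : l ≤ n) :
    ∑ j ∈ range (n + 1), 4 ^ j * α j ≤ 4 * (4 ^ n * α n) := by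
  have hα_nonneg := (hα_pos n).le
  calc ∑ j ∈ range (n + 1), 4 ^ j * α j
      = ∑ i ∈ range (n + 1), 4 ^ (n - i) * α (n - i) :=
        (sum_range_reflect (fun j => 4 ^ j * α j) (n + 1)).symm
    _ ≤ ∑ i ∈ range (n + 1), 4 ^ n * α n * (3 / 4) ^ i := by
        refine sum_le_sum fun i hi => ?_
        obtain ⟨j, rfl⟩ := Nat.exists_eq_add_of_le' (mem_range_succ_iff.1 hi)
        rw [Nat.add_sub_cancel]
        exact hα.four_pow_mul_le hα_pos hn
    _ = 4 ^ n * α n * ∑ i ∈ range (n + 1), (3 / 4) ^ i := (mul_sum _ _ _).symm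
    _ ≤ 4 ^ n * α n * (1 - 3 / 4)⁻¹ := by
        gcongr
        exact (summable_geometric_of_lt_one (by norm_num) (by norm_num)).sum_le_tsum _
          (fun i _ => by positivity) |>.trans_eq
          (tsum_geometric_of_lt_one (by norm_num) (by norm_num))
    _ = 4 * (4 ^ n * α n) := by ring

end FactorialGrowth

/-! ### Coefficients and `L²` norm of a polynomial -/

section ChebyshevExpansion

open Polynomial Finset Real

lemma exists_eq_sum_smul_U {F : Type*} [Field F] [NeZero (2 : F)] {n : ℕ} {p : F[X]}
    (hp : p.degree < n) :
    ∃ c : ℕ → F, p = ∑ j ∈ range n, c j • Chebyshev.U F j := by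
  let S : Polynomial.Sequence F :=
    ⟨fun j => Chebyshev.U F j, fun j => Chebyshev.degree_U_natCast F j⟩
  have hspan : p ∈ Submodule.span F ((fun j : ℕ => Chebyshev.U F (j : ℤ)) '' range n) := by
    rw [coe_range]
    refine (S.span_degreeLT fun j _ => (leadingCoeff_ne_zero.2 (S.ne_zero j)).isUnit).ge ?_
    exact mem_degreeLT.2 hp
  exact ((Submodule.mem_span_image_finset_iff_exists_fun' F).1 hspan).imp fun _ => Eq.symm

lemma integral_cos_int_mul {m : ℤ} (hm : m ≠ 0) : ∫ θ in (0 : ℝ)..π, cos (m * θ) = 0 := by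
  rw [intervalIntegral.integral_comp_mul_left cos (Int.cast_ne_zero.2 hm), integral_cos]
  simp

lemma integral_sin_mul_sin (a b : ℕ) :
    ∫ θ in (0 : ℝ)..π, sin ((a + 1) * θ) * sin ((b + 1) * θ) = if a = b then π / 2 else 0 := by
  have hprod : ∀ θ : ℝ, sin ((a + 1) * θ) * sin ((b + 1) * θ) =
      1 / 2 * (cos (((a - b : ℤ) : ℝ) * θ) - cos (((a + b + 2 : ℤ) : ℝ) * θ)) := fun θ => by
    rw [show ((a - b : ℤ) : ℝ) * θ = (a + 1) * θ - (b + 1) * θ by push_cast; ring,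
      show ((a + b + 2 : ℤ) : ℝ) * θ = (a + 1) * θ + (b + 1) * θ by push_cast; ring,
      cos_sub, cos_add]
    ring
  simp_rw [hprod]
  rw [intervalIntegral.integral_const_mul, intervalIntegral.integral_sub
    (Continuous.intervalIntegrable (by fun_prop) _ _)
    (Continuous.intervalIntegrable (by fun_prop) _ _),
    integral_cos_int_mul (by omega : (a + b + 2 : ℤ) ≠ 0), sub_zero]
  split_ifs with hab
  · subst hab
    simp [div_eq_inv_mul]
  · rw [integral_cos_int_mul (by omega), mul_zero]

lemma integral_sq_sum_sin (s : Finset ℕ) (c : ℕ → ℝ) :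
    ∫ θ in (0 : ℝ)..π, (∑ j ∈ s, c j * sin ((j + 1) * θ)) ^ 2 = π / 2 * ∑ j ∈ s, c j ^ 2 := by
  have hterm : ∀ i j : ℕ, ∫ θ in (0 : ℝ)..π, c i * sin ((i + 1) * θ) * (c j * sin ((j + 1) * θ)) =
      if i = j then π / 2 * c i ^ 2 else 0 := fun i j => by
    simp_rw [mul_mul_mul_comm (c i)]
    rw [intervalIntegral.integral_const_mul, integral_sin_mul_sin]
    split_ifs with hij
    · rw [hij]; ring
    · rw [mul_zero]
  simp_rw [sq (∑ _ ∈ s, _), sum_mul_sum]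
  rw [intervalIntegral.integral_finsetSum fun i _ =>
    Continuous.intervalIntegrable (by fun_prop) _ _, mul_sum]
  refine sum_congr rfl fun i hi => ?_
  rw [intervalIntegral.integral_finsetSum fun j _ =>
    Continuous.intervalIntegrable (by fun_prop) _ _]
  simp_rw [hterm, sum_ite_eq, if_pos hi]

lemma integral_eq_integral_cos_mul_sin {g : ℝ → ℝ} (hg : Continuous g) :
    ∫ x in (-1 : ℝ)..1, g x = ∫ θ in (0 : ℝ)..π, g (cos θ) * sin θ := by
  have h := intervalIntegral.integral_comp_mul_deriv (a := 0) (b := π)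
    (fun θ _ => hasDerivAt_cos θ) (by fun_prop) hg
  simp only [Function.comp_apply, cos_zero, cos_pi, mul_neg] at h
  rw [intervalIntegral.integral_neg, intervalIntegral.integral_symm (-1)] at h
  exact (neg_injective h).symm

lemma pi_div_two_mul_sum_sq_le_integral_sq (s : Finset ℕ) (c : ℕ → ℝ) :
    π / 2 * ∑ j ∈ s, c j ^ 2 ≤
      ∫ x in (-1 : ℝ)..1, (∑ j ∈ s, c j • Chebyshev.U ℝ j).eval x ^ 2 := by
  rw [integral_eq_integral_cos_mul_sin (by fun_prop), ← integral_sq_sum_sin]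
  refine intervalIntegral.integral_mono_on pi_pos.le
    (Continuous.intervalIntegrable (by fun_prop) _ _)
    (Continuous.intervalIntegrable (by fun_prop) _ _) fun θ hθ => ?_
  have hsin : ∑ j ∈ s, c j * sin ((j + 1) * θ) =
      (∑ j ∈ s, c j • Chebyshev.U ℝ j).eval (cos θ) * sin θ := by
    rw [eval_finsetSum, sum_mul]
    refine sum_congr rfl fun j _ => ?_
    rw [eval_smul, smul_eq_mul, mul_assoc, Chebyshev.U_real_cos, Int.cast_natCast]
  rw [hsin, mul_pow]
  exact mul_le_mul_of_nonneg_left (pow_le_of_le_one (sin_nonneg_of_mem_Icc hθ) (sin_le_one θ)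
    two_ne_zero) (sq_nonneg _)

lemma sum_mul_sq_coeff_sum_smul_le {R ι : Type*} [CommRing R] [LinearOrder R]
    [IsStrictOrderedRing R] {w : ℕ → R} (hw : ∀ k, 0 ≤ w k) (t : Finset ℕ) (s : Finset ι)
    (c : ι → R) (q : ι → R[X]) :
    ∑ k ∈ t, w k * (∑ j ∈ s, c j • q j).coeff k ^ 2 ≤
      (∑ j ∈ s, c j ^ 2) * ∑ j ∈ s, ∑ k ∈ t, w k * (q j).coeff k ^ 2 := by
  calc ∑ k ∈ t, w k * (∑ j ∈ s, c j • q j).coeff k ^ 2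
      ≤ ∑ k ∈ t, w k * ((∑ j ∈ s, c j ^ 2) * ∑ j ∈ s, (q j).coeff k ^ 2) := by
        refine sum_le_sum fun k _ => mul_le_mul_of_nonneg_left ?_ (hw k)
        simp only [finsetSum_coeff, coeff_smul, smul_eq_mul]
        exact sum_mul_sq_le_sq_mul_sq s c fun j => (q j).coeff k
    _ = (∑ j ∈ s, c j ^ 2) * ∑ j ∈ s, ∑ k ∈ t, w k * (q j).coeff k ^ 2 := by
        simp_rw [mul_left_comm (w _), ← mul_sum]
        rw [sum_comm]
        simp_rw [mul_sum]

lemma FactorialRatioBound.sum_mul_sq_coeff_le {α : ℕ → ℝ} {l : ℝ} (hα : FactorialRatioBound α l)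
    (hα_pos : ∀ k, 0 < α k) {n : ℕ} (hn : l ≤ n) {p : ℝ[X]} (hp : p.natDegree ≤ n) :
    ∑ k ∈ range (n + 1), α k * p.coeff k ^ 2 ≤
      8 / π * exp (l ^ 2 / 16) * (4 ^ n * α n) * ∫ x in (-1 : ℝ)..1, p.eval x ^ 2 := by
  obtain ⟨c, rfl⟩ := exists_eq_sum_smul_U (n := n + 1)
    ((degree_le_of_natDegree_le hp).trans_lt (WithBot.coe_lt_coe.2 n.lt_succ_self))
  set I := ∫ x in (-1 : ℝ)..1, (∑ j ∈ range (n + 1), c j • Chebyshev.U ℝ j).eval x ^ 2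
  have hc : ∑ j ∈ range (n + 1), c j ^ 2 ≤ 2 / π * I := by
    rw [div_mul_eq_mul_div, le_div_iff₀ pi_pos]
    linarith [pi_div_two_mul_sum_sq_le_integral_sq (range (n + 1)) c]
  have hU : ∑ j ∈ range (n + 1), ∑ k ∈ range (n + 1), α k * (Chebyshev.U ℝ j).coeff k ^ 2 ≤
      4 * (4 ^ n * α n) * exp (l ^ 2 / 16) := calc
    _ ≤ ∑ j ∈ range (n + 1), 4 ^ j * α j * exp (l ^ 2 / 16) :=
        sum_le_sum fun j hj => hα.sum_mul_sq_coeff_U_le hα_pos (mem_range_succ_iff.1 hj)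
    _ = (∑ j ∈ range (n + 1), 4 ^ j * α j) * exp (l ^ 2 / 16) := (sum_mul _ _ _).symm
    _ ≤ 4 * (4 ^ n * α n) * exp (l ^ 2 / 16) := by
        gcongr
        exact hα.sum_four_pow_mul_le hα_pos hn
  calc _ ≤ (∑ j ∈ range (n + 1), c j ^ 2) *
        ∑ j ∈ range (n + 1), ∑ k ∈ range (n + 1), α k * (Chebyshev.U ℝ j).coeff k ^ 2 :=
        sum_mul_sq_coeff_sum_smul_le (fun k => (hα_pos k).le) _ _ c _
    _ ≤ 2 / π * I * (4 * (4 ^ n * α n) * exp (l ^ 2 / 16)) := by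
        have hc_nonneg : 0 ≤ ∑ j ∈ range (n + 1), c j ^ 2 := sum_nonneg fun _ _ => sq_nonneg _
        exact mul_le_mul hc hU (sum_nonneg fun _ _ => sum_nonneg fun k _ =>
          mul_nonneg (hα_pos k).le (sq_nonneg _)) (hc_nonneg.trans hc)
    _ = 8 / π * exp (l ^ 2 / 16) * (4 ^ n * α n) * I := by ring

end ChebyshevExpansion

/-! ### Interpolation at the Chebyshev nodes -/

section Interpolation

open Polynomial

/-- The error `p ↦ p(x) - (Lp)(x)` at `x` of Lagrange interpolation at the nodes `v`, as a linear
functional on polynomials. -/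
def interpError {F ι : Type*} [Field F] [Fintype ι] [DecidableEq ι] (v : ι → F) (x : F) :
    F[X] →ₗ[F] F :=
  leval x ∘ₗ (LinearMap.id -
    Lagrange.interpolate Finset.univ v ∘ₗ LinearMap.pi fun j => leval (v j))

section

variable {F ι : Type*} [Field F] [Fintype ι] [DecidableEq ι] {v : ι → F} {x : F}

lemma interpError_apply (p : F[X]) :
    interpError v x p =
      p.eval x - ∑ j, p.eval (v j) * (Lagrange.basis Finset.univ v j).eval x := by
  simp [interpError, leval_apply, Lagrange.interpolate_apply, eval_finsetSum]

lemma interpError_congr {p q : F[X]} (h : ∀ j, q.eval (v j) = p.eval (v j)) :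
    interpError v x p = p.eval x - q.eval x + interpError v x q := by
  simp only [interpError_apply, h]
  ring

lemma interpError_eq_zero (hv : Function.Injective v) {p : F[X]}
    (hp : p.degree < Fintype.card ι) : interpError v x p = 0 := by
  have h : p = Lagrange.interpolate Finset.univ v fun j => p.eval (v j) :=
    Lagrange.eq_interpolate hv.injOn hp
  simpa [interpError, leval_apply, sub_eq_zero] using congrArg (eval x) h

end

/-- The zeros of the Chebyshev polynomial `Tₙ`. -/
def chebyshevNode (n : ℕ) (k : Fin n) : ℝ := Real.cos ((2 * (k : ℕ) + 1) * Real.pi / (2 * n))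

lemma chebyshevNode_mem (n : ℕ) (k : Fin n) : chebyshevNode n k ∈ Set.Icc (-1 : ℝ) 1 :=
  Real.cos_mem_Icc _

lemma chebyshevNode_injective (n : ℕ) : Function.Injective (chebyshevNode n) := by
  have h := Chebyshev.roots_T_real_nodup n
  rw [← Finset.range_val, (Finset.range n).nodup_map_iff_injOn] at h
  exact fun a b hab => Fin.ext (h (by simp) (by simp) hab)

lemma eval_T_chebyshevNode (n : ℕ) (k : Fin n) :
    (Chebyshev.T ℝ n).eval (chebyshevNode n k) = 0 := by
  refine isRoot_of_mem_roots ?_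
  rw [Chebyshev.roots_T_real, Finset.mem_val]
  exact Finset.mem_image_of_mem _ (Finset.mem_range.2 k.2)

variable {n : ℕ}

lemma exists_degree_lt_eval_eq_T (hn : 0 < n) (k : ℕ) : ∃ q : ℝ[X], q.degree < n ∧
    (∀ x ∈ Set.Icc (-1 : ℝ) 1, |q.eval x| ≤ 1) ∧
    ∀ j, q.eval (chebyshevNode n j) = (Chebyshev.T ℝ k).eval (chebyshevNode n j) := by
  induction k using Nat.strong_induction_on with
  | _ k ih =>
    rcases lt_trichotomy k n with h | rfl | h
    · refine ⟨Chebyshev.T ℝ k, ?_, fun x hx => ?_, fun _ => rfl⟩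
      · simpa [Chebyshev.degree_T] using h
      · exact Chebyshev.abs_eval_T_real_le_one _ (abs_le.2 hx)
    · exact ⟨0, by simp, by simp, fun j => by rw [eval_T_chebyshevNode, eval_zero]⟩
    · -- `2 T_n T_{k-n} = T_k + T_{2n-k}`, so `T_k = -T_{|2n-k|}` on the zeros of `T_n`.
      obtain ⟨q, hq, hq_le, hq_eval⟩ := ih ((n : ℤ) - (k - n : ℕ)).natAbs (by omega)
      refine ⟨-q, by simpa using hq, by simpa using hq_le, fun j => ?_⟩
      have hmul := congrArg (eval (chebyshevNode n j)) (Chebyshev.T_mul_T ℝ n ((k - n : ℕ) : ℤ))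
      rw [eval_mul, eval_mul, eval_T_chebyshevNode, eval_add, ← Chebyshev.T_natAbs _ (_ - _),
        ← hq_eval j, show ((n : ℤ) + (k - n : ℕ)) = k by omega] at hmul
      rw [eval_neg]
      linarith

variable {x : ℝ}

lemma abs_interpError_T_le (hn : 0 < n) (hx : x ∈ Set.Icc (-1 : ℝ) 1) (k : ℤ) :
    |interpError (chebyshevNode n) x (Chebyshev.T ℝ k)| ≤ 2 := by
  rw [← Chebyshev.T_natAbs]
  obtain ⟨q, hq, hq_le, hq_eval⟩ := exists_degree_lt_eval_eq_T hn k.natAbs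
  rw [interpError_congr hq_eval,
    interpError_eq_zero (chebyshevNode_injective n) (by simpa using hq), add_zero]
  linarith [abs_sub ((Chebyshev.T ℝ (k.natAbs : ℤ)).eval x) (q.eval x), hq_le x hx,
    Chebyshev.abs_eval_T_real_le_one k.natAbs (abs_le.2 hx)]

variable {s : ℝ}

lemma abs_interpError_T_le_zpow (hn : 0 < n) (hx : x ∈ Set.Icc (-1 : ℝ) 1) (hs : 0 < s)
    (hs_le : s ≤ 1) (k : ℤ) :
    |interpError (chebyshevNode n) x (Chebyshev.T ℝ k)| ≤
      2 * (s ^ ((n : ℤ) - k) + s ^ ((n : ℤ) + k)) := by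
  have hsub : 0 < s ^ ((n : ℤ) - k) := zpow_pos hs _
  have hadd : 0 < s ^ ((n : ℤ) + k) := zpow_pos hs _
  by_cases hk : k.natAbs < n
  · rw [interpError_eq_zero (chebyshevNode_injective n)
      (by simpa [Chebyshev.degree_T] using hk), abs_zero]
    positivity
  · refine (abs_interpError_T_le hn hx k).trans ?_
    rcases le_total 0 k with h₀ | h₀
    · linarith [one_le_zpow_of_nonpos₀ hs hs_le (by omega : (n : ℤ) - k ≤ 0)]
    · linarith [one_le_zpow_of_nonpos₀ hs hs_le (by omega : (n : ℤ) + k ≤ 0)]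

lemma X_mul_T_eq (k : ℤ) :
    X * Chebyshev.T ℝ k = (1 / 2 : ℝ) • (Chebyshev.T ℝ (k + 1) + Chebyshev.T ℝ (k - 1)) := by
  rw [Chebyshev.T_add_one, sub_add_cancel, mul_assoc, ← C_ofNat, ← smul_eq_C_mul, smul_smul]
  norm_num

lemma abs_interpError_X_pow_mul_T_le (hn : 0 < n) (hx : x ∈ Set.Icc (-1 : ℝ) 1) (hs : 0 < s)
    (hs_le : s ≤ 1) (N : ℕ) (k : ℤ) :
    |interpError (chebyshevNode n) x (X ^ N * Chebyshev.T ℝ k)| ≤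
      2 * ((s + s⁻¹) / 2) ^ N * (s ^ ((n : ℤ) - k) + s ^ ((n : ℤ) + k)) := by
  induction N generalizing k with
  | zero => simpa using abs_interpError_T_le_zpow hn hx hs hs_le k
  | succ N ih =>
    rw [pow_succ X, mul_assoc, X_mul_T_eq, mul_smul_comm, mul_add, map_smul, map_add, smul_eq_mul,
      abs_mul, abs_of_pos one_half_pos]
    calc 1 / 2 * |_ + _|
        ≤ 1 / 2 * (2 * ((s + s⁻¹) / 2) ^ N * (s ^ ((n : ℤ) - (k + 1)) + s ^ ((n : ℤ) + (k + 1))) +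
          2 * ((s + s⁻¹) / 2) ^ N * (s ^ ((n : ℤ) - (k - 1)) + s ^ ((n : ℤ) + (k - 1)))) := by
          gcongr
          exact (abs_add_le _ _).trans (add_le_add (ih (k + 1)) (ih (k - 1)))
      _ = 2 * ((s + s⁻¹) / 2) ^ (N + 1) * (s ^ ((n : ℤ) - k) + s ^ ((n : ℤ) + k)) := by
          rw [← sub_sub, ← add_assoc, sub_sub_eq_add_sub, ← sub_add_eq_add_sub, ← add_sub_assoc]
          simp only [zpow_sub_one₀ hs.ne', zpow_add_one₀ hs.ne']
          ring

lemma abs_interpError_X_pow_le (hn : 0 < n) (hx : x ∈ Set.Icc (-1 : ℝ) 1) (hs : 0 < s)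
    (hs_le : s ≤ 1) (N : ℕ) :
    |interpError (chebyshevNode n) x (X ^ N)| ≤ 4 * s ^ n * ((s + s⁻¹) / 2) ^ N := by
  have h := abs_interpError_X_pow_mul_T_le hn hx hs hs_le N 0
  rw [Chebyshev.T_zero, mul_one, sub_zero, add_zero, zpow_natCast] at h
  linarith

end Interpolation

section MonomialErrors

open Polynomial Finset
open scoped Nat

variable {n : ℕ} {x r : ℝ}

lemma sq_interpError_X_pow_le (hn : 0 < n) (hx : x ∈ Set.Icc (-1 : ℝ) 1) (hr : 0 < r)
    (hr_le : r ≤ 1) (N : ℕ) :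
    interpError (chebyshevNode n) x (X ^ N) ^ 2 ≤ 16 * r ^ n * ((1 + r) ^ 2 / (4 * r)) ^ N := by
  have hs : 0 < √r := Real.sqrt_pos.2 hr
  have hs_sq : √r ^ 2 = r := Real.sq_sqrt hr.le
  have hsq : ((√r + (√r)⁻¹) / 2) ^ 2 = (1 + r) ^ 2 / (4 * r) := by
    rw [add_div, add_sq, div_pow, div_pow, inv_pow, hs_sq]
    field_simp
    ring
  calc interpError (chebyshevNode n) x (X ^ N) ^ 2
      = |interpError (chebyshevNode n) x (X ^ N)| ^ 2 := (sq_abs _).symm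
    _ ≤ (4 * √r ^ n * ((√r + (√r)⁻¹) / 2) ^ N) ^ 2 := by
        gcongr
        exact abs_interpError_X_pow_le hn hx hs (Real.sqrt_le_one.2 hr_le) N
    _ = 16 * (√r ^ 2) ^ n * (((√r + (√r)⁻¹) / 2) ^ 2) ^ N := by
        rw [mul_pow, mul_pow, pow_right_comm, pow_right_comm _ N]
        norm_num
    _ = 16 * r ^ n * ((1 + r) ^ 2 / (4 * r)) ^ N := by rw [hs_sq, hsq]

variable {α : ℕ → ℝ} {l : ℝ}

lemma FactorialRatioBound.inv_le (hα : FactorialRatioBound α l) (hα_pos : ∀ k, 0 < α k)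
    (hn : 0 < n) (m : ℕ) : (α (n + m))⁻¹ ≤ (α n)⁻¹ * (l / n) ^ m := by
  have hl := hα.pos hα_pos
  have hfactorial : (n ! : ℝ) * (n : ℝ) ^ m ≤ (n + m)! := by
    exact_mod_cast (Nat.mul_le_mul_left _ (Nat.pow_le_pow_left n.le_succ m)).trans
      Nat.factorial_mul_pow_le_factorial
  have hratio : l ^ m * ((n ! : ℝ) / ((n + m)! : ℝ)) ≤ (l / n) ^ m := by
    rw [div_pow, ← mul_div_assoc, div_le_div_iff₀ (by positivity) (by positivity), mul_assoc]
    gcongr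
  rw [inv_mul_eq_div, le_div_iff₀ (hα_pos n), inv_mul_le_iff₀ (hα_pos _), mul_comm]
  exact (hα.le_mul hα_pos n m).trans (mul_le_mul_of_nonneg_right hratio (hα_pos _).le)

lemma FactorialRatioBound.inv_mul_sq_interpError_le (hα : FactorialRatioBound α l)
    (hα_pos : ∀ k, 0 < α k) (hn : 0 < n) (hln : 5 * l ≤ n) (hx : x ∈ Set.Icc (-1 : ℝ) 1)
    (m : ℕ) :
    (α (n + m))⁻¹ * interpError (chebyshevNode n) x (X ^ (n + m)) ^ 2 ≤
      (α n)⁻¹ * (1 / 4) ^ n * (16 * Real.exp l) * (5 / 8) ^ m := by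
  have hl := hα.pos hα_pos
  have hαn := inv_pos.2 (hα_pos n)
  have : (0 : ℝ) < n := Nat.cast_pos.2 hn
  -- With `r` of order `l / n`, the factor `(1 + r) ^ (2 * n)` stays bounded and
  -- `(l / n) * (1 + r) ^ 2 / (4 * r)` stays below `1`.
  set r := l / (2 * n) with hr_def
  have hr : 0 < r := by positivity
  have hr_le : r ≤ 1 / 10 := by
    rw [hr_def, div_le_iff₀ (by positivity)]
    linarith
  have hratio : (1 + r) ^ 2 / 2 ≤ 5 / 8 := by nlinarith
  have hexp : (1 + r) ^ (2 * n) ≤ Real.exp l := by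
    have h := Real.one_sub_div_pow_le_exp_neg (n := 2 * n) (t := -l) (by push_cast; linarith)
    rwa [neg_div, sub_neg_eq_add, neg_neg, Nat.cast_mul, Nat.cast_ofNat] at h
  have hlr : l / n = 2 * r := by
    rw [hr_def]
    field_simp
  calc (α (n + m))⁻¹ * interpError (chebyshevNode n) x (X ^ (n + m)) ^ 2
      ≤ ((α n)⁻¹ * (2 * r) ^ m) * (16 * r ^ n * ((1 + r) ^ 2 / (4 * r)) ^ (n + m)) := by
        rw [← hlr]
        gcongr
        · exact hα.inv_le hα_pos hn m
        · exact sq_interpError_X_pow_le hn hx hr (by linarith) (n + m)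
    _ = (α n)⁻¹ * (16 * (r * ((1 + r) ^ 2 / (4 * r))) ^ n) *
          (2 * r * ((1 + r) ^ 2 / (4 * r))) ^ m := by
        rw [pow_add, mul_pow r, mul_pow (2 * r)]
        ring
    _ = (α n)⁻¹ * (1 / 4) ^ n * (16 * (1 + r) ^ (2 * n)) * ((1 + r) ^ 2 / 2) ^ m := by
        rw [show r * ((1 + r) ^ 2 / (4 * r)) = 1 / 4 * (1 + r) ^ 2 by field_simp,
          show 2 * r * ((1 + r) ^ 2 / (4 * r)) = (1 + r) ^ 2 / 2 by field_simp; norm_num,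
          mul_pow (1 / 4 : ℝ), pow_mul]
        ring
    _ ≤ (α n)⁻¹ * (1 / 4) ^ n * (16 * Real.exp l) * (5 / 8) ^ m := by
        gcongr

lemma FactorialRatioBound.tsum_inv_mul_sq_interpError_le (hα : FactorialRatioBound α l)
    (hα_pos : ∀ k, 0 < α k) (hn : 0 < n) (hln : 5 * l ≤ n) (hx : x ∈ Set.Icc (-1 : ℝ) 1) :
    ∑' k, (α k)⁻¹ * interpError (chebyshevNode n) x (X ^ k) ^ 2 ≤
      (α n)⁻¹ * (1 / 4) ^ n * (43 * Real.exp l) := by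
  have hαn := inv_pos.2 (hα_pos n)
  set F : ℕ → ℝ := fun k => (α k)⁻¹ * interpError (chebyshevNode n) x (X ^ k) ^ 2
  set C := (α n)⁻¹ * (1 / 4) ^ n * (16 * Real.exp l)
  have hF : ∀ k, 0 ≤ F k := fun k => mul_nonneg (inv_pos.2 (hα_pos k)).le (sq_nonneg _)
  have hF_lt : ∑ k ∈ range n, F k = 0 := sum_eq_zero fun k hk => by
    have hdeg : (X ^ k : ℝ[X]).degree < Fintype.card (Fin n) := by
      simpa using hk
    simp [F, interpError_eq_zero (chebyshevNode_injective n) hdeg]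
  have hgeom : HasSum (fun m : ℕ => C * (5 / 8) ^ m) (C * (1 - 5 / 8)⁻¹) :=
    (hasSum_geometric_of_lt_one (by norm_num) (by norm_num)).mul_left C
  have hle : ∀ m, F (m + n) ≤ C * (5 / 8) ^ m := fun m => by
    simpa only [add_comm m n] using hα.inv_mul_sq_interpError_le hα_pos hn hln hx m
  have hsummable : Summable fun m => F (m + n) :=
    .of_nonneg_of_le (fun m => hF (m + n)) hle hgeom.summable
  calc ∑' k, F k = ∑' m, F (m + n) := by
        rw [← ((summable_nat_add_iff n).1 hsummable).sum_add_tsum_nat_add n, hF_lt, zero_add]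
    _ ≤ C * (1 - 5 / 8)⁻¹ := hasSum_le hle hsummable.hasSum hgeom
    _ = (α n)⁻¹ * (1 / 4) ^ n * (128 / 3 * Real.exp l) := by ring
    _ ≤ (α n)⁻¹ * (1 / 4) ^ n * (43 * Real.exp l) := by
        gcongr
        norm_num

end MonomialErrors

/-! ### Numerical bounds for the constant `c_L` -/

section Constants

open Real

variable {l y : ℝ} {n : ℕ}

lemma exp_div_le_cL (hl : 0 < l) :
    29 / 5 * exp (-(3 / 2) * l) / (2 * √π * l ^ (1 / 4 : ℝ)) ≤ cL l := by
  have hsqrt_l : 0 < √l := sqrt_pos.2 hl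
  have hsqrt_div : 1 ≤ √(π / exp 1) := by
    rw [one_le_sqrt, one_le_div (exp_pos _)]
    linarith [exp_one_lt_d9, pi_gt_three]
  have hinv : 0 ≤ 2 / (√π * l ^ (1 / 4 : ℝ)) := by positivity
  have hamgm : 9 / 5 ≤ 7 / (16 * √l) + √l * 2 := by
    rw [div_add' _ _ _ (by positivity), le_div_iff₀ (by positivity)]
    nlinarith [sq_nonneg (√l - 9 / 20)]
  have hsqrt_mul : 0 ≤ √l * l := by positivity
  rw [cL, mul_comm (29 / 5), mul_div_right_comm]
  gcongr <;> linarith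

lemma mul_one_add_le_exp (hy : 3 ≤ y) (hly : 11 / 5 * l ≤ y) :
    25 / 2 * (1 + 43 / 50 * (y - 3)) ≤ exp (2 * y - 5 / 2 * l) := by
  have hexp_two : 369 / 50 ≤ exp 2 := by
    rw [show (2 : ℝ) = 1 + 1 by norm_num, exp_add]
    nlinarith [exp_one_gt_d9]
  have hexp : 25 / 2 ≤ exp (2 + 29 / 50) := by
    rw [exp_add]
    calc (25 / 2 : ℝ) ≤ 369 / 50 * (1 + 29 / 50 + (29 / 50) ^ 2 / 2) := by norm_num
      _ ≤ exp 2 * exp (29 / 50) := by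
          gcongr
          exact quadratic_le_exp_of_nonneg (by norm_num)
  have hlin : 1 + 43 / 50 * (y - 3) ≤ exp (43 / 50 * (y - 3)) := by
    rw [add_comm]
    exact add_one_le_exp _
  calc 25 / 2 * (1 + 43 / 50 * (y - 3))
      ≤ exp (2 + 29 / 50) * exp (43 / 50 * (y - 3)) := by
        gcongr
    _ ≤ exp (2 * y - 5 / 2 * l) := by
        rw [← exp_add, exp_le_exp]
        linarith

lemma mul_sqrt_le_exp (hy : 3 ≤ y) (hly : 11 / 5 * l ≤ y) :
    43 * (2 * √π * √y) ≤ 4 * (29 / 5) * exp (2 * y - 5 / 2 * l) := by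
  have hsqrt_pi : √π ≤ 71 / 40 := by
    rw [sqrt_le_left (by norm_num)]
    linarith [pi_lt_d2]
  have hsqrt_y : √y ≤ 29 / 100 * (y + 3) := by
    rw [sqrt_le_left (by positivity)]
    nlinarith [sq_nonneg (y - 3)]
  have hmul : √π * √y ≤ 71 / 40 * (29 / 100 * (y + 3)) := by gcongr
  calc 43 * (2 * √π * √y) = 86 * (√π * √y) := by ring
    _ ≤ 4 * (29 / 5) * (25 / 2 * (1 + 43 / 50 * (y - 3))) := by linarith
    _ ≤ 4 * (29 / 5) * exp (2 * y - 5 / 2 * l) := by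
        gcongr
        exact mul_one_add_le_exp hy hly

lemma mul_exp_le_cL (hl : 0 < l) (hln : 5 * l ≤ n) (hnl : 9 / l ≤ n) :
    43 * exp l ≤ 4 * (cL l * (n : ℝ) ^ (-(1 / 4) : ℝ) * exp (2 * √(l * n))) := by
  have hn : (0 : ℝ) < n := by linarith
  have hy : 3 ≤ √(l * n) := by
    rw [div_le_iff₀ hl] at hnl
    exact le_sqrt_of_sq_le (by linarith)
  have hly : 11 / 5 * l ≤ √(l * n) := le_sqrt_of_sq_le (by nlinarith)
  have hroot : l ^ (1 / 4 : ℝ) * (n : ℝ) ^ (1 / 4 : ℝ) = √√(l * n) := by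
    rw [← mul_rpow hl.le hn.le, sqrt_eq_rpow, sqrt_eq_rpow, ← rpow_mul (by positivity)]
    norm_num
  set y := √(l * n)
  have : 0 < √y := sqrt_pos.2 (by linarith)
  calc 43 * exp l
      = 43 * (2 * √π * √y) * exp l / (2 * √π * √y) := by field_simp
    _ ≤ 4 * (29 / 5) * exp (2 * y - 5 / 2 * l) * exp l / (2 * √π * √y) := by
        gcongr ?_ * _ / _
        exact mul_sqrt_le_exp hy hly
    _ = 4 * (29 / 5 * exp (-(3 / 2) * l) / (2 * √π * l ^ (1 / 4 : ℝ)) *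
          (n : ℝ) ^ (-(1 / 4) : ℝ) * exp (2 * y)) := by
        rw [mul_assoc, ← exp_add, show 2 * y - 5 / 2 * l + l = -(3 / 2) * l + 2 * y by ring,
          exp_add, ← hroot, rpow_neg hn.le]
        field_simp
    _ ≤ 4 * (cL l * (n : ℝ) ^ (-(1 / 4) : ℝ) * exp (2 * y)) := by
        gcongr
        exact exp_div_le_cL hl

end Constants

/-! ### Bounds for the minimal error -/

section MinimalError

open Polynomial

lemma phiMin_le (φ : Interval → ℝ) (x : Interval) : phiMin φ ≤ |φ x| :=
  ciInf_le ⟨0, Set.forall_mem_range.2 fun _ => abs_nonneg _⟩ x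

lemma phiMin_nonneg (φ : Interval → ℝ) : 0 ≤ phiMin φ := Real.iInf_nonneg fun _ => abs_nonneg _

lemma phiMax_nonneg (φ : Interval → ℝ) : 0 ≤ phiMax φ := Real.iSup_nonneg fun _ => abs_nonneg _

lemma lebesgue_univ : lebesgue Set.univ = 2 := by
  rw [lebesgue, comap_subtype_coe_apply measurableSet_Icc, Set.image_univ, Subtype.range_coe,
    Real.volume_Icc]
  norm_num

instance : IsFiniteMeasure lebesgue := ⟨lebesgue_univ ▸ ENNReal.ofNat_lt_top⟩

lemma integral_lebesgue (f : ℝ → ℝ) :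
    ∫ x : Interval, f x ∂lebesgue = ∫ x in (-1 : ℝ)..1, f x := by
  rw [intervalIntegral.integral_of_le (by norm_num), ← integral_Icc_eq_integral_Ioc]
  exact integral_subtype_comap measurableSet_Icc f

lemma eLpNorm_eval (p : ℝ[X]) :
    eLpNorm (fun x : Interval => p.eval (x : ℝ)) 2 lebesgue =
      ENNReal.ofReal (√(∫ x in (-1 : ℝ)..1, p.eval x ^ 2)) := by
  have hcont : Continuous fun x : Interval => p.eval (x : ℝ) := by fun_prop
  obtain ⟨C, hC⟩ := (isCompact_range hcont).isBounded.exists_norm_le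
  have hmem : MemLp (fun x : Interval => p.eval (x : ℝ)) 2 lebesgue :=
    .of_bound hcont.aestronglyMeasurable C (.of_forall fun x => hC _ ⟨x, rfl⟩)
  rw [hmem.eLpNorm_eq_integral_rpow_norm (by norm_num) (by norm_num), ← integral_lebesgue,
    Real.sqrt_eq_rpow]
  simp

lemma eLpNorm_le_of_two_mul_sq_le {f : Interval → ℝ} {C : ℝ} (hC : 0 ≤ C)
    (hf : ∀ x, 2 * f x ^ 2 ≤ C ^ 2) : eLpNorm f 2 lebesgue ≤ ENNReal.ofReal C := by
  have hbound : ∀ x, ‖f x‖ ≤ C / √2 := fun x => by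
    refine abs_le_of_sq_le_sq ?_ (by positivity)
    rw [div_pow, Real.sq_sqrt zero_le_two, le_div_iff₀ two_pos, mul_comm]
    exact hf x
  have hmass : lebesgue Set.univ ^ ((2 : ℝ≥0∞).toReal⁻¹) = ENNReal.ofReal √2 := by
    rw [lebesgue_univ, Real.sqrt_eq_rpow, ← ENNReal.ofReal_rpow_of_pos two_pos]
    norm_num
  refine (eLpNorm_le_of_ae_bound (.of_forall hbound)).trans_eq ?_
  rw [hmass, ← ENNReal.ofReal_mul (Real.sqrt_nonneg _), mul_div_cancel₀ _ (by positivity)]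

section

variable {H : Type*} [NormedAddCommGroup H] [InnerProductSpace ℝ H] [RKHS ℝ H Interval ℝ] {n : ℕ}

lemma le_minimalError {c : ℝ≥0∞} (h : ∀ x : Fin n → Interval, ∃ f : H, f ≠ 0 ∧
    (∀ j, f (x j) = 0) ∧ c * ‖f‖ₑ ≤ eLpNorm (fun x => f x) 2 lebesgue) : c ≤ minimalError H n := by
  refine le_iInf fun A => ?_
  obtain ⟨f, hf_ne, hf, hle⟩ := h A.point
  refine le_iSup₂_of_le f hf_ne ?_
  rw [ENNReal.le_div_iff_mul_le (.inl (by simpa using hf_ne)) (.inl enorm_ne_top)]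
  simpa only [LinearApprox.apply, hf, zero_mul, Finset.sum_const_zero, sub_zero] using hle

lemma minimalError_le_of_sq_le (A : LinearApprox n) {R : ℝ} (hR : 0 ≤ R)
    (h : ∀ (f : H) (x : Interval), 2 * (f x - A.apply f x) ^ 2 ≤ R ^ 2 * ‖f‖ ^ 2) :
    minimalError H n ≤ ENNReal.ofReal R := by
  refine (iInf_le _ A).trans (iSup₂_le fun f _ => ENNReal.div_le_of_le_mul ?_)
  rw [← ofReal_norm, ← ENNReal.ofReal_mul hR]
  exact eLpNorm_le_of_two_mul_sq_le (by positivity) fun x => mul_pow R ‖f‖ 2 ▸ h f x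

end

lemma two_rpow_neg_sq (n : ℕ) : ((2 : ℝ) ^ (-(n : ℝ))) ^ 2 = (1 / 4) ^ n := by
  rw [Real.rpow_neg zero_le_two, Real.rpow_natCast, ← inv_pow, pow_right_comm]
  norm_num

lemma rpow_neg_half_sq {a : ℝ} (ha : 0 < a) : (a ^ (-(1 / 2) : ℝ)) ^ 2 = a⁻¹ := by
  rw [← Real.rpow_mul_natCast ha.le, ← Real.rpow_neg_one]
  norm_num

variable {φ : Interval → ℝ} {α : ℕ → ℝ} {l : ℝ} {n : ℕ}

lemma phiMin_mul_sqrt_integral_le_eLpNorm (p : ℝ[X]) :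
    ENNReal.ofReal (phiMin φ * √(∫ x in (-1 : ℝ)..1, p.eval x ^ 2)) ≤
      eLpNorm (fun x => φ x * p.eval (x : ℝ)) 2 lebesgue := by
  rw [ENNReal.ofReal_mul (phiMin_nonneg φ), ← eLpNorm_eval,
    ← Real.enorm_of_nonneg (phiMin_nonneg φ), ← eLpNorm_const_smul]
  refine eLpNorm_mono fun x => ?_
  rw [Pi.smul_apply, smul_eq_mul, norm_mul, norm_mul, Real.norm_of_nonneg (phiMin_nonneg φ)]
  gcongr
  exact phiMin_le φ x

lemma sq_cLower_mul_le (hl : 0 ≤ l) :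
    cLower l φ ^ 2 * (8 / Real.pi * Real.exp (l ^ 2 / 16)) ≤ phiMin φ ^ 2 := by
  have hexp : Real.exp (-(1 / 32) * l ^ 2) ^ 2 * Real.exp (l ^ 2 / 16) = 1 := by
    rw [← Real.exp_nat_mul, ← Real.exp_add, Real.exp_eq_one_iff]
    push_cast
    ring
  have hexp_six : Real.exp 3 ^ 2 = Real.exp 6 := by
    rw [← Real.exp_nat_mul]
    norm_num
  have hsq : cLower l φ ^ 2 = 8 * Real.pi / (9 * Real.exp 6 * (4 + l)) *
      Real.exp (-(1 / 32) * l ^ 2) ^ 2 * phiMin φ ^ 2 := by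
    rw [cLower, mul_pow, mul_pow, div_pow, mul_pow, mul_pow, mul_pow, hexp_six,
      Real.sq_sqrt (by positivity), Real.sq_sqrt (by positivity)]
    ring
  have hconst : 64 / (9 * Real.exp 6 * (4 + l)) ≤ 1 := by
    rw [div_le_one (by positivity)]
    nlinarith [Real.add_one_le_exp 6]
  calc cLower l φ ^ 2 * (8 / Real.pi * Real.exp (l ^ 2 / 16))
      = 64 / (9 * Real.exp 6 * (4 + l)) *
          (Real.exp (-(1 / 32) * l ^ 2) ^ 2 * Real.exp (l ^ 2 / 16)) * phiMin φ ^ 2 := by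
        rw [hsq]
        field_simp
        ring
    _ ≤ phiMin φ ^ 2 := by
        rw [hexp, mul_one]
        exact mul_le_of_le_one_left (sq_nonneg _) hconst

lemma two_mul_le_sq_cUpper_mul (hα_pos : ∀ k, 0 < α k) (hl : 0 < l) (hln : 5 * l ≤ n)
    (hnl : 9 / l ≤ n) :
    2 * (phiMax φ ^ 2 * ((α n)⁻¹ * (1 / 4) ^ n * (43 * Real.exp l))) ≤
      (cUpper l φ * (n : ℝ) ^ (-(1 / 8) : ℝ) * Real.exp (√(l * n)) * (2 : ℝ) ^ (-(n : ℝ)) *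
        α n ^ (-(1 / 2) : ℝ)) ^ 2 := by
  have hαn := inv_pos.2 (hα_pos n)
  have hcL : 0 ≤ cL l := le_trans (by positivity) (exp_div_le_cL hl)
  have hrpow : ((n : ℝ) ^ (-(1 / 8) : ℝ)) ^ 2 = (n : ℝ) ^ (-(1 / 4) : ℝ) := by
    rw [← Real.rpow_mul_natCast n.cast_nonneg]
    norm_num
  have hexp : Real.exp (√(l * n)) ^ 2 = Real.exp (2 * √(l * n)) := (Real.exp_nat_mul _ 2).symm
  have hcUpper : cUpper l φ ^ 2 = 8 * cL l * phiMax φ ^ 2 := by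
    rw [cUpper, mul_pow, mul_pow, Real.sq_sqrt (by positivity)]
    ring
  calc 2 * (phiMax φ ^ 2 * ((α n)⁻¹ * (1 / 4) ^ n * (43 * Real.exp l)))
      ≤ 2 * (phiMax φ ^ 2 * ((α n)⁻¹ * (1 / 4) ^ n *
          (4 * (cL l * (n : ℝ) ^ (-(1 / 4) : ℝ) * Real.exp (2 * √(l * n)))))) := by
        gcongr 2 * (_ * (_ * ?_))
        exact mul_exp_le_cL hl hln hnl
    _ = _ := by
        rw [mul_pow, mul_pow, mul_pow, mul_pow, hcUpper, hrpow, hexp, two_rpow_neg_sq,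
          rpow_neg_half_sq (hα_pos n)]
        ring

variable {H : Type*} [NormedAddCommGroup H] [InnerProductSpace ℝ H] [CompleteSpace H]
  [RKHS ℝ H Interval ℝ]

lemma FactorialRatioBound.exists_fooling_function (hα : FactorialRatioBound α l)
    (hα_pos : ∀ k, 0 < α k) (hα_sum : Summable fun k => (α k)⁻¹) (hφ_pos : 0 < phiMin φ)
    (hH : IsRKHSOf H (kernel φ α)) (hn : l ≤ n) (x : Fin n → Interval) :
    ∃ f : H, f ≠ 0 ∧ (∀ j, f (x j) = 0) ∧
      ENNReal.ofReal (cLower l φ * (2 : ℝ) ^ (-(n : ℝ)) * α n ^ (-(1 / 2) : ℝ)) * ‖f‖ₑ ≤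
        eLpNorm (fun x => f x) 2 lebesgue := by
  have hl := hα.pos hα_pos
  have hαn := hα_pos n
  set p : ℝ[X] := Lagrange.nodal Finset.univ fun j => (x j : ℝ) with hp
  have hdeg : p.natDegree = n := by simp [hp, Lagrange.natDegree_nodal]
  obtain ⟨f, hf, hf_norm⟩ := hH.exists_apply_eq_mul_eval hα_pos hα_sum p
  refine ⟨f, ?_, fun j => ?_, ?_⟩
  · rintro rfl
    refine Lagrange.nodal_ne_zero (eq_zero_of_infinite_isRoot p ?_)
    refine (Set.Icc_infinite (by norm_num : (-1 : ℝ) < 1)).mono fun y hy => ?_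
    have hφy : φ ⟨y, hy⟩ ≠ 0 := abs_pos.1 (hφ_pos.trans_le (phiMin_le φ _))
    simpa [hφy] using (hf ⟨y, hy⟩).symm
  · rw [hf, hp, Lagrange.eval_nodal_at_node (v := fun j => (x j : ℝ)) (Finset.mem_univ j), mul_zero]
  set I := ∫ x in (-1 : ℝ)..1, p.eval x ^ 2
  have hI : 0 ≤ I := intervalIntegral.integral_nonneg (by norm_num) fun _ _ => sq_nonneg _
  have hf_le : ‖f‖ ^ 2 ≤ 8 / Real.pi * Real.exp (l ^ 2 / 16) * (4 ^ n * α n) * I :=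
    (hdeg ▸ hf_norm).trans (hα.sum_mul_sq_coeff_le hα_pos hn hdeg.le)
  have hmain : cLower l φ * (2 : ℝ) ^ (-(n : ℝ)) * α n ^ (-(1 / 2) : ℝ) * ‖f‖ ≤ phiMin φ * √I := by
    refine le_of_sq_le_sq ?_ (mul_nonneg hφ_pos.le (Real.sqrt_nonneg _))
    calc (cLower l φ * (2 : ℝ) ^ (-(n : ℝ)) * α n ^ (-(1 / 2) : ℝ) * ‖f‖) ^ 2
        = cLower l φ ^ 2 * (1 / 4) ^ n * (α n)⁻¹ * ‖f‖ ^ 2 := by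
          rw [mul_pow, mul_pow, mul_pow, two_rpow_neg_sq, rpow_neg_half_sq hαn]
      _ ≤ cLower l φ ^ 2 * (1 / 4) ^ n * (α n)⁻¹ *
            (8 / Real.pi * Real.exp (l ^ 2 / 16) * (4 ^ n * α n) * I) := by gcongr
      _ = cLower l φ ^ 2 * (8 / Real.pi * Real.exp (l ^ 2 / 16)) * I := by
          rw [div_pow, one_pow]
          field_simp
      _ ≤ phiMin φ ^ 2 * I := mul_le_mul_of_nonneg_right (sq_cLower_mul_le hl.le) hI
      _ = (phiMin φ * √I) ^ 2 := by rw [mul_pow, Real.sq_sqrt hI]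
  simp only [hf]
  rw [← ofReal_norm, ← ENNReal.ofReal_mul' (norm_nonneg _)]
  exact (ENNReal.ofReal_le_ofReal hmain).trans (phiMin_mul_sqrt_integral_le_eLpNorm p)

lemma FactorialRatioBound.cLower_mul_le_minimalError (hα : FactorialRatioBound α l)
    (hα_pos : ∀ k, 0 < α k) (hα_sum : Summable fun k => (α k)⁻¹)
    (hH : IsRKHSOf H (kernel φ α)) (hn : l ≤ n) :
    ENNReal.ofReal (cLower l φ * (2 : ℝ) ^ (-(n : ℝ)) * α n ^ (-(1 / 2) : ℝ)) ≤
      minimalError H n := by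
  rcases (phiMin_nonneg φ).eq_or_lt with hφ_zero | hφ_pos
  · simp [cLower, ← hφ_zero]
  · exact le_minimalError (hα.exists_fooling_function hα_pos hα_sum hφ_pos hH hn)

/-- The approximation of `f` by `φ` times the polynomial interpolating `f / φ` at the Chebyshev
nodes. It interpolates only when `φ` does not vanish at the nodes. -/
def chebyshevApprox (hφ : NullMeasurable φ lebesgue) (n : ℕ) : LinearApprox n where
  point j := ⟨chebyshevNode n j, chebyshevNode_mem n j⟩
  point_injective _ _ h := chebyshevNode_injective n (congrArg Subtype.val h)
  weight j x := φ x / φ ⟨chebyshevNode n j, chebyshevNode_mem n j⟩ *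
    (Lagrange.basis Finset.univ (chebyshevNode n) j).eval (x : ℝ)
  weight_measurable j := by
    have hbasis : Continuous fun x : Interval =>
      (Lagrange.basis Finset.univ (chebyshevNode n) j).eval (x : ℝ) := by fun_prop
    exact ((hφ.aemeasurable.div_const _).mul hbasis.aemeasurable).nullMeasurable

lemma sub_sum_chebyshevApprox_weight_mul (hφ : NullMeasurable φ lebesgue) (hφ_ne : ∀ x, φ x ≠ 0)
    (x : Interval) (k : ℕ) :
    φ x * (x : ℝ) ^ k - ∑ j, (chebyshevApprox hφ n).weight j x *
        (φ ((chebyshevApprox hφ n).point j) * ((chebyshevApprox hφ n).point j : ℝ) ^ k) =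
      φ x * interpError (chebyshevNode n) x (X ^ k) := by
  rw [interpError_apply, mul_sub, Finset.mul_sum, eval_pow, eval_X]
  congr! 2 with j
  have hφj := hφ_ne ⟨chebyshevNode n j, chebyshevNode_mem n j⟩
  simp only [chebyshevApprox, eval_pow, eval_X]
  field_simp

lemma FactorialRatioBound.sq_sub_chebyshevApprox_le (hα : FactorialRatioBound α l)
    (hα_pos : ∀ k, 0 < α k) (hα_sum : Summable fun k => (α k)⁻¹) (hφ : NullMeasurable φ lebesgue)
    (hφ_ne : ∀ x, φ x ≠ 0) (hφ_bdd : BddAbove (Set.range fun x => |φ x|))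
    (hH : IsRKHSOf H (kernel φ α)) (hn : 0 < n) (hln : 5 * l ≤ n) (f : H) (x : Interval) :
    (f x - (chebyshevApprox hφ n).apply f x) ^ 2 ≤
      phiMax φ ^ 2 * ((α n)⁻¹ * (1 / 4) ^ n * (43 * Real.exp l)) * ‖f‖ ^ 2 := by
  set A := chebyshevApprox hφ n with hA
  have hφx : φ x ^ 2 ≤ phiMax φ ^ 2 :=
    sq_le_sq.2 ((le_ciSup hφ_bdd x).trans (le_abs_self (phiMax φ)))
  have hsum : ∑' k, (α k)⁻¹ * (φ x * (x : ℝ) ^ k -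
      ∑ j, A.weight j x * (φ (A.point j) * (A.point j : ℝ) ^ k)) ^ 2 =
        φ x ^ 2 * ∑' k, (α k)⁻¹ * interpError (chebyshevNode n) x (X ^ k) ^ 2 := by
    simp only [hA, sub_sum_chebyshevApprox_weight_mul hφ hφ_ne, mul_pow, mul_left_comm (α _)⁻¹,
      tsum_mul_left]
  calc (f x - A.apply f x) ^ 2
      = (f x - ∑ j, A.weight j x * f (A.point j)) ^ 2 := by
        simp only [LinearApprox.apply, mul_comm]
    _ ≤ _ * ‖f‖ ^ 2 :=
        hH.sq_apply_sub_sum_le hα_pos hα_sum Finset.univ (fun j => A.weight j x) A.point x f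
    _ ≤ phiMax φ ^ 2 * ((α n)⁻¹ * (1 / 4) ^ n * (43 * Real.exp l)) * ‖f‖ ^ 2 := by
        rw [hsum]
        gcongr ?_ * _
        refine mul_le_mul hφx ?_ (tsum_nonneg fun k => ?_) (sq_nonneg _)
        · exact hα.tsum_inv_mul_sq_interpError_le hα_pos hn hln x.2
        · exact mul_nonneg (inv_nonneg.2 (hα_pos k).le) (sq_nonneg _)

lemma FactorialRatioBound.minimalError_le_cUpper_mul (hα : FactorialRatioBound α l)
    (hα_pos : ∀ k, 0 < α k) (hα_sum : Summable fun k => (α k)⁻¹) (hφ : NullMeasurable φ lebesgue)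
    (hφ_ne : ∀ x, φ x ≠ 0) (hφ_bdd : BddAbove (Set.range fun x => |φ x|))
    (hH : IsRKHSOf H (kernel φ α)) (hln : 5 * l ≤ n) (hnl : 9 / l ≤ n) :
    minimalError H n ≤
      ENNReal.ofReal (cUpper l φ * (n : ℝ) ^ (-(1 / 8) : ℝ) * Real.exp (√(l * n)) *
        (2 : ℝ) ^ (-(n : ℝ)) * α n ^ (-(1 / 2) : ℝ)) := by
  have hl := hα.pos hα_pos
  have hn : (0 : ℝ) < n := by linarith
  have hαn := hα_pos n
  have hcUpper : 0 ≤ cUpper l φ := mul_nonneg (by positivity) (phiMax_nonneg φ)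
  refine minimalError_le_of_sq_le (chebyshevApprox hφ n) (by positivity) fun f x => ?_
  calc 2 * (f x - (chebyshevApprox hφ n).apply f x) ^ 2
      ≤ 2 * (phiMax φ ^ 2 * ((α n)⁻¹ * (1 / 4) ^ n * (43 * Real.exp l)) * ‖f‖ ^ 2) := by
        gcongr
        exact hα.sq_sub_chebyshevApprox_le hα_pos hα_sum hφ hφ_ne hφ_bdd hH (mod_cast hn) hln f x
    _ = 2 * (phiMax φ ^ 2 * ((α n)⁻¹ * (1 / 4) ^ n * (43 * Real.exp l))) * ‖f‖ ^ 2 := by ring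
    _ ≤ _ := by
        gcongr
        exact two_mul_le_sq_cUpper_mul hα_pos hl hln hnl

end MinimalError

end PowerSeriesKernel

end

theorem theorem4p4_general
    (φ : PowerSeriesKernel.Interval → ℝ) (hφ_meas : NullMeasurable φ PowerSeriesKernel.lebesgue)
    (hφ_ne : ∀ x, φ x ≠ 0) (hφ_sup : BddAbove (Set.range fun x => |φ x|))
    (α : ℕ → ℝ) (hα_pos : ∀ k, 0 < α k) (hα_sum : Summable fun k => (α k)⁻¹)
    (l : ℝ) (hα : PowerSeriesKernel.FactorialRatioBound α l)
    {H : Type*} [NormedAddCommGroup H] [InnerProductSpace ℝ H] [CompleteSpace H]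
    [RKHS ℝ H PowerSeriesKernel.Interval ℝ]
    (hH : PowerSeriesKernel.IsRKHSOf H (PowerSeriesKernel.kernel φ α))
    (n : ℕ) (hln : 5 * l ≤ n) (hnl : 9 / l ≤ n) :
    ENNReal.ofReal (PowerSeriesKernel.cLower l φ * (2 : ℝ) ^ (-(n : ℝ)) * α n ^ (-(1 / 2) : ℝ))
        ≤ PowerSeriesKernel.minimalError H n ∧
      PowerSeriesKernel.minimalError H n ≤
        ENNReal.ofReal (PowerSeriesKernel.cUpper l φ * (n : ℝ) ^ (-(1 / 8) : ℝ) *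
          Real.exp (√(l * n)) * (2 : ℝ) ^ (-(n : ℝ)) * α n ^ (-(1 / 2) : ℝ)) := by
  have hl : l ≤ n := by linarith [hα.pos hα_pos]
  exact ⟨hα.cLower_mul_le_minimalError hα_pos hα_sum hH hl,
    hα.minimalError_le_cUpper_mul hα_pos hα_sum hφ_meas hφ_ne hφ_sup hH hln hnl⟩

theorem theorem4p4
    (φ : PowerSeriesKernel.Interval → ℝ) (hφ_meas : NullMeasurable φ PowerSeriesKernel.lebesgue)
    (hφ_inf : 0 < PowerSeriesKernel.phiMin φ) (hφ_sup : BddAbove (Set.range fun x => |φ x|))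
    (α : ℕ → ℝ) (hα_pos : ∀ k, 0 < α k) (hα_sum : Summable fun k => (α k)⁻¹)
    (l : ℝ) (hl : 0 < l)
    (hα : ∀ n k : ℕ, k ≤ n →
      α k / α n ≤ l ^ (n - k) * ((k.factorial : ℝ) / (n.factorial : ℝ)))
    {H : Type*} [NormedAddCommGroup H] [InnerProductSpace ℝ H] [CompleteSpace H]
    [RKHS ℝ H PowerSeriesKernel.Interval ℝ]
    (hH : PowerSeriesKernel.IsRKHSOf H (PowerSeriesKernel.kernel φ α))
    (n : ℕ) (hn : PowerSeriesKernel.mL l ≤ (n : ℝ)) :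
    ENNReal.ofReal (PowerSeriesKernel.cLower l φ * (2 : ℝ) ^ (-(n : ℝ)) * α n ^ (-(1 / 2) : ℝ))
        ≤ PowerSeriesKernel.minimalError H n ∧
      PowerSeriesKernel.minimalError H n ≤
        ENNReal.ofReal (PowerSeriesKernel.cUpper l φ * (n : ℝ) ^ (-(1 / 8) : ℝ) *
          Real.exp (√(l * n)) * (2 : ℝ) ^ (-(n : ℝ)) * α n ^ (-(1 / 2) : ℝ)) := by
  have hφ_ne : ∀ x, φ x ≠ 0 := fun x =>
    abs_pos.1 (hφ_inf.trans_le (PowerSeriesKernel.phiMin_le φ x))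
  exact theorem4p4_general φ hφ_meas hφ_ne hφ_sup α hα_pos hα_sum l hα hH n
    ((le_max_left _ _).trans hn) ((le_max_of_le_right (le_max_right _ _)).trans hn)
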